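/- Let $X$ be a compact (Hausdorff) smooth manifold of dimension $2n$. On $TX\oplus T^*X$ consider the pairing $\langle Y+\xi,Z+\eta\rangle=\frac12(\xi(Z)+\eta(Y))$ and the Courant bracket $[Y+\xi,Z+\eta]=[Y,Z]+\mathcal L_Y\eta-\mathcal L_Z\xi-\frac12\,d(\iota_Y\eta-\iota_Z\xi)$. A generalized-almost-complex structure on $X$ is a smooth $\langle\cdot,\cdot\rangle$-orthogonal endomorphism $\mathcal J$ of $TX\oplus T^*X$ with $\mathcal J^2=-\mathrm{id}$; it is a generalized-complex structure if $-[\mathcal Js,\mathcal Jt]+\mathcal J[\mathcal Js,t]+\mathcal J[s,\mathcal Jt]+[s,t]=0$ for all smooth sections $s,t$ of $TX\oplus T^*X$. Let $L\subseteq(TX\oplus T^*X)\otimes\mathbb C$ be the $i$-eigenbundle of $\mathcal J$, let $(Y+\xi)\cdot\varphi=\iota_Y\varphi+\xi\wedge\varphi$ be the Clifford action on forms (extended $\mathbb C$-bilinearly), and let $U\subseteq\wedge^\bullet T^*X\otimes\mathbb C$ be the complex line bundle generated by the $\rho$ whose Clifford annihilator is precisely $L$. For $k\in\mathbb Z$ put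 $U^k_{\mathcal J}=\wedge^{n-k}\bar L\cdot U$, and let $GH^{(k)}_{\mathcal J}(X)$ be the subspace of the de Rham cohomology $GH_{dR}(X)=\ker d/\operatorname{im}d$ of complex differential forms (of mixed degree) that consists of the classes represented by $d$-closed smooth sections of $U^k_{\mathcal J}$. The structure $\mathcal J$ is called $\mathcal C^\infty$-pure-and-full if $GH_{dR}(X)=\bigoplus_{k\in\mathbb Z}GH^{(k)}_{\mathcal J}(X)$, that is, if the sum of the subspaces $GH^{(k)}_{\mathcal J}(X)$ is direct and equals $GH_{dR}(X)$. Let $B$ be a $d$-closed real smooth $2$-form on $X$, and let $\mathcal J_B=\exp(-B)\,\mathcal J\,\exp(B)$ be the $B$-transform of $\mathcal J$, where $\exp(B)(Y+\xi)=Y+\xi+\iota_YB$. Then a generalized-complex structure $\mathcal J$ on $X$ is $\mathcal C^\infty$-pure-and-full if and only if its $B$-transform $\mathcal J_B$ is. -/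

import Mathlib

open scoped Manifold ContDiff TensorProduct

noncomputable section

namespace GenCplx

/-! ### Linear algebra on one tangent space `V` -/

section LinearAlgebra

variable (V : Type*) [NormedAddCommGroup V] [NormedSpace ℝ V]

/-- The generalized tangent space `V ⊕ V*`. -/
abbrev GenVec : Type _ := V × (V →L[ℝ] ℝ)

/-- The complex multiforms `Λ^• V* ⊗ ℂ`; the component of index `k` is the one of degree `k`
(for finite-dimensional `V` it is automatically zero if `k > dim V`). -/
def Multiform : Type _ := ∀ k : ℕ, V [⋀^Fin k]→L[ℝ] ℂ

instance : AddCommGroup (Multiform V) :=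
  inferInstanceAs (AddCommGroup (∀ k : ℕ, V [⋀^Fin k]→L[ℝ] ℂ))

instance : Module ℂ (Multiform V) :=
  inferInstanceAs (Module ℂ (∀ k : ℕ, V [⋀^Fin k]→L[ℝ] ℂ))

variable {V}

theorem Multiform.zero_apply (k : ℕ) (v : Fin k → V) : (0 : Multiform V) k v = 0 := rfl

theorem Multiform.add_apply (φ ψ : Multiform V) (k : ℕ) (v : Fin k → V) :
    (φ + ψ) k v = φ k v + ψ k v := rfl

theorem Multiform.smul_apply (c : ℂ) (φ : Multiform V) (k : ℕ) (v : Fin k → V) :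
    (c • φ) k v = c * φ k v := rfl

theorem Multiform.real_smul_apply (c : ℝ) (φ : Multiform V) (k : ℕ) (v : Fin k → V) :
    (c • φ) k v = c * φ k v := rfl

theorem Multiform.ext {φ ψ : Multiform V} (h : ∀ (k : ℕ) (v : Fin k → V), φ k v = ψ k v) :
    φ = ψ :=
  funext fun k => ContinuousAlternatingMap.ext (h k)

/-- The pairing `⟨X + ξ, Y + η⟩ = (ξ(Y) + η(X)) / 2` on `V ⊕ V*`. -/
def pairing (a b : GenVec V) : ℝ := (1 / 2) * (a.2 b.1 + b.2 a.1)

/-- The exterior product `ξ ∧ φ` of a covector with a `k`-form,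
`(ξ ∧ φ)(v₀, …, v_k) = ∑ i, (-1)^i ξ(v_i) φ(v₀, …, v̂_i, …, v_k)`. -/
def wedgeCovector {k : ℕ} (ξ : V →L[ℝ] ℝ) (φ : V [⋀^Fin k]→L[ℝ] ℂ) :
    V [⋀^Fin (k + 1)]→L[ℝ] ℂ :=
  ContinuousAlternatingMap.alternatizeUncurryFin (ξ.smulRight φ)

/-- The Clifford action `(X + ξ) · φ = ι_X φ + ξ ∧ φ` of a generalized vector on a multiform. -/
def cliffordFun (a : GenVec V) (φ : Multiform V) : Multiform V
  | 0 => (φ 1).curryLeft a.1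
  | k + 1 => (φ (k + 2)).curryLeft a.1 + wedgeCovector a.2 (φ k)

theorem cliffordFun_zero_apply (a : GenVec V) (φ : Multiform V) (v : Fin 0 → V) :
    cliffordFun a φ 0 v = φ 1 (Matrix.vecCons a.1 v) := rfl

theorem cliffordFun_succ_apply (a : GenVec V) (φ : Multiform V) (k : ℕ) (v : Fin (k + 1) → V) :
    cliffordFun a φ (k + 1) v = φ (k + 2) (Matrix.vecCons a.1 v) +
      ∑ i : Fin (k + 1), (-1 : ℂ) ^ (i : ℕ) * ((a.2 (v i) : ℂ) * φ k (i.removeNth v)) := by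
  simp [cliffordFun, wedgeCovector, ContinuousAlternatingMap.alternatizeUncurryFin_apply]

theorem vecCons_add {k : ℕ} (φ : V [⋀^Fin (k + 1)]→L[ℝ] ℂ) (a b : V) (v : Fin k → V) :
    φ (Matrix.vecCons (a + b) v) = φ (Matrix.vecCons a v) + φ (Matrix.vecCons b v) :=
  congrArg (fun ψ => ψ v) (map_add φ.curryLeft a b)

theorem vecCons_smul {k : ℕ} (φ : V [⋀^Fin (k + 1)]→L[ℝ] ℂ) (c : ℝ) (a : V) (v : Fin k → V) :
    φ (Matrix.vecCons (c • a) v) = c * φ (Matrix.vecCons a v) :=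
  congrArg (fun ψ => ψ v) (map_smul φ.curryLeft c a)

/-- The Clifford action as a bilinear map. -/
def clifford : GenVec V →ₗ[ℝ] Multiform V →ₗ[ℂ] Multiform V :=
  LinearMap.mk₂' ℝ ℂ cliffordFun
    (by
      intro a b φ
      refine Multiform.ext fun k v => ?_
      cases k with
      | zero => simp [cliffordFun_zero_apply, Multiform.add_apply, vecCons_add]
      | succ k =>
        simp [cliffordFun_succ_apply, Multiform.add_apply, vecCons_add, add_mul, mul_add,
          Finset.sum_add_distrib]
        ring)
    (by
      intro c a φ
      refine Multiform.ext fun k v => ?_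
      cases k with
      | zero => simp [cliffordFun_zero_apply, Multiform.real_smul_apply, vecCons_smul]
      | succ k =>
        simp [cliffordFun_succ_apply, Multiform.real_smul_apply, vecCons_smul, mul_add,
          Finset.mul_sum]
        exact Finset.sum_congr rfl fun i _ => by ring)
    (by
      intro a φ ψ
      refine Multiform.ext fun k v => ?_
      cases k with
      | zero => simp [cliffordFun_zero_apply, Multiform.add_apply]
      | succ k =>
        simp [cliffordFun_succ_apply, Multiform.add_apply, mul_add, Finset.sum_add_distrib]
        ring)
    (by
      intro c a φ
      refine Multiform.ext fun k v => ?_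
      cases k with
      | zero => simp [cliffordFun_zero_apply, Multiform.smul_apply]
      | succ k =>
        simp [cliffordFun_succ_apply, Multiform.smul_apply, mul_add, Finset.mul_sum]
        exact Finset.sum_congr rfl fun i _ => by ring)

/-- The bi-`ℂ`-linear extension of the Clifford action to `(V ⊕ V*) ⊗ ℂ`. -/
def cliffordC : (ℂ ⊗[ℝ] GenVec V) →ₗ[ℂ] Multiform V →ₗ[ℂ] Multiform V :=
  LinearMap.liftBaseChange ℂ clifford

/-- The `i`-eigenspace `L ⊆ (V ⊕ V*) ⊗ ℂ` of the `ℂ`-linear extension of `J`. -/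
def eigenL (J : GenVec V →L[ℝ] GenVec V) : Submodule ℂ (ℂ ⊗[ℝ] GenVec V) :=
  Module.End.eigenspace ((J : GenVec V →ₗ[ℝ] GenVec V).baseChange ℂ) Complex.I

/-- Complex conjugation on `(V ⊕ V*) ⊗ ℂ`. -/
def conjC : (ℂ ⊗[ℝ] GenVec V) →ₗ[ℝ] (ℂ ⊗[ℝ] GenVec V) :=
  LinearMap.rTensor (GenVec V) Complex.conjAe.toLinearMap

theorem conjC_smul (c : ℂ) (v : ℂ ⊗[ℝ] GenVec V) :
    conjC (c • v) = (starRingEnd ℂ c) • conjC v := by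
  induction v using TensorProduct.induction_on with
  | zero => simp
  | tmul z a => simp [conjC, TensorProduct.smul_tmul']
  | add v w hv hw => rw [smul_add, map_add, hv, hw, map_add, smul_add]

/-- The complex conjugate `L̄` of `L`. -/
def eigenLbar (J : GenVec V →L[ℝ] GenVec V) : Submodule ℂ (ℂ ⊗[ℝ] GenVec V) where
  carrier := {v | conjC v ∈ eigenL J}
  zero_mem' := by simp
  add_mem' := by
    intro v w hv hw
    simpa using add_mem hv hw
  smul_mem' := by
    intro c v hv
    simpa [conjC_smul] using Submodule.smul_mem _ _ hv

/-- The complex line `U` generated by the multiforms whose Clifford annihilator is precisely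
`L`. -/
def spinorLine (J : GenVec V →L[ℝ] GenVec V) : Submodule ℂ (Multiform V) :=
  Submodule.span ℂ {ρ | ∀ v : ℂ ⊗[ℝ] GenVec V, v ∈ eigenL J ↔ cliffordC v ρ = 0}

/-- `Λ^m L̄ · U`: the span of all `v₁ · (v₂ · ( … (v_m · ρ)))` with `v_j ∈ L̄` and `ρ ∈ U`.
(As `L̄` is isotropic for the structures of interest, the subalgebra that it generates in the
Clifford algebra is its exterior algebra, and the products of `m` of its elements span
`Λ^m L̄`.) -/
def lbarPowU (J : GenVec V →L[ℝ] GenVec V) : ℕ → Submodule ℂ (Multiform V)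
  | 0 => spinorLine J
  | m + 1 => Submodule.map₂ cliffordC (eigenLbar J) (lbarPowU J m)

/-- `U^k = Λ^{n-k} L̄ · U` for `k : ℤ`, where `dim V = 2n`; it is zero if `n - k < 0`. -/
def gradedU (n : ℕ) (J : GenVec V →L[ℝ] GenVec V) (k : ℤ) : Submodule ℂ (Multiform V) :=
  if k ≤ n then lbarPowU J (n - k).toNat else ⊥

/-- A `2`-form viewed as the map `V → V*`, `X ↦ ι_X θ`, that is, `Y ↦ θ(X, Y)`. -/
def twoFormMap (θ : V [⋀^Fin 2]→L[ℝ] ℝ) : V →L[ℝ] (V →L[ℝ] ℝ) :=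
  ((ContinuousAlternatingMap.ofSubsingletonLIE (𝕜 := ℝ) (E := V) (F := ℝ)
    (0 : Fin 1)).symm.toContinuousLinearEquiv : (V [⋀^Fin 1]→L[ℝ] ℝ) →L[ℝ] (V →L[ℝ] ℝ)) ∘L
    θ.curryLeft

theorem twoFormMap_apply (θ : V [⋀^Fin 2]→L[ℝ] ℝ) (X Y : V) :
    twoFormMap θ X Y = θ ![X, Y] := by
  change θ _ = θ _
  congr 1
  funext i
  fin_cases i <;> rfl

/-- The map `exp B = (1 0; B 1)` on `V ⊕ V*`, that is, `X + ξ ↦ X + (ξ + ι_X B)`. -/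
def expB (B : V [⋀^Fin 2]→L[ℝ] ℝ) : GenVec V →L[ℝ] GenVec V :=
  ContinuousLinearMap.id ℝ (GenVec V) +
    ContinuousLinearMap.inr ℝ V (V →L[ℝ] ℝ) ∘L twoFormMap B ∘L
      ContinuousLinearMap.fst ℝ V (V →L[ℝ] ℝ)

theorem expB_apply (B : V [⋀^Fin 2]→L[ℝ] ℝ) (a : GenVec V) :
    expB B a = (a.1, a.2 + twoFormMap B a.1) := by
  simp [expB, Prod.ext_iff]

end LinearAlgebra

/-! ### Smooth objects on a manifold `M` modelled on `E`

The tangent space `TangentSpace 𝓘(ℝ, E) x` is by definition a copy of `E`, attached to `x`, so that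
tensor fields on `M` are functions on `M` with values in the tensors of `E`, and `mfderiv` gives
the changes of coordinates. -/

section Manifold

variable {E : Type*} [NormedAddCommGroup E] [NormedSpace ℝ E]
  {M : Type*} [TopologicalSpace M] [ChartedSpace E M]
  {F : Type*} [NormedAddCommGroup F] [NormedSpace ℝ F]

variable (M) in
/-- The differential at `y : E` of the inverse of the chart around `x₀`,
a map from `E` to the tangent space of `M`. -/
def dChartSymm (x₀ : M) (y : E) : E →L[ℝ] E :=
  mfderiv 𝓘(ℝ, E) 𝓘(ℝ, E) (chartAt E x₀).symm y

variable (E) in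
/-- The differential at `x : M` of the chart around `x₀`, a map from the tangent space to `E`. -/
def dChart (x₀ x : M) : E →L[ℝ] E :=
  mfderiv 𝓘(ℝ, E) 𝓘(ℝ, E) (chartAt E x₀) x

/-- The expression of an `F`-valued `k`-form in the chart around `x₀`. -/
def formInChart {k : ℕ} (θ : M → E [⋀^Fin k]→L[ℝ] F) (x₀ : M) (y : E) : E [⋀^Fin k]→L[ℝ] F :=
  (θ ((chartAt E x₀).symm y)).compContinuousLinearMap (dChartSymm M x₀ y)

/-- Smoothness of an `F`-valued `k`-form on `M`. -/
def SmoothForm {k : ℕ} (θ : M → E [⋀^Fin k]→L[ℝ] F) : Prop :=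
  ∀ x₀ : M, ContDiffOn ℝ ∞ (formInChart θ x₀) (chartAt E x₀).target

/-- The exterior derivative of a `k`-form on `M`, computed at `x` in the chart around `x`. -/
def extD {k : ℕ} (θ : M → E [⋀^Fin k]→L[ℝ] F) (x : M) : E [⋀^Fin (k + 1)]→L[ℝ] F :=
  (extDeriv (formInChart θ x) (chartAt E x x)).compContinuousLinearMap (dChart E x x)

/-- The isomorphism from the generalized tangent space `T_xM ⊕ T_x^*M` at `x = φ⁻¹(y)` to
`E ⊕ E*` given by the chart `φ` around `x₀`: vectors are pushed forward along `φ`, covectors are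
pulled back along `φ⁻¹`. -/
def genToChart (x₀ : M) (y : E) : GenVec E →L[ℝ] GenVec E :=
  (dChart E x₀ ((chartAt E x₀).symm y)).prodMap
    ((ContinuousLinearMap.compL ℝ E E ℝ).flip (dChartSymm M x₀ y))

/-- The inverse isomorphism, from `E ⊕ E*` to the generalized tangent space. -/
def genOfChart (x₀ : M) (y : E) : GenVec E →L[ℝ] GenVec E :=
  (dChartSymm M x₀ y).prodMap
    ((ContinuousLinearMap.compL ℝ E E ℝ).flip (dChart E x₀ ((chartAt E x₀).symm y)))

/-- Smoothness of a section of `TM ⊕ T^*M`. -/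
def SmoothSection (s : M → GenVec E) : Prop :=
  ∀ x₀ : M, ContDiffOn ℝ ∞ (fun y => genToChart x₀ y (s ((chartAt E x₀).symm y)))
    (chartAt E x₀).target

/-- The expression in the chart around `x₀` of a field of endomorphisms of `TM ⊕ T^*M`. -/
def endoInChart (J : M → GenVec E →L[ℝ] GenVec E) (x₀ : M) (y : E) :
    GenVec E →L[ℝ] GenVec E :=
  genToChart x₀ y ∘L J ((chartAt E x₀).symm y) ∘L genOfChart x₀ y

/-- Smoothness of a field of endomorphisms of `TM ⊕ T^*M`. -/
def SmoothEndo (J : M → GenVec E →L[ℝ] GenVec E) : Prop :=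
  ∀ x₀ : M, ContDiffOn ℝ ∞ (endoInChart J x₀) (chartAt E x₀).target

/-! ### The Courant bracket -/

/-- The differential of a real function. -/
def dFun (f : M → ℝ) (x : M) : E →L[ℝ] ℝ :=
  mfderiv 𝓘(ℝ, E) 𝓘(ℝ, ℝ) f x

/-- The Lie derivative `ℒ_X η = ι_X dη + d ι_X η` of a `1`-form. -/
def lieDerivOneForm (X : M → E) (η : M → E →L[ℝ] ℝ) (x : M) : E →L[ℝ] ℝ :=
  twoFormMap (extD (fun z => ContinuousAlternatingMap.ofSubsingleton ℝ E ℝ (0 : Fin 1) (η z)) x)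
    (X x) + dFun (fun z => η z (X z)) x

/-- The Lie bracket of vector fields. -/
def lieBracketField (X Y : M → E) (x : M) : E :=
  VectorField.mlieBracket 𝓘(ℝ, E) X Y x

/-- The Courant bracket
`[X + ξ, Y + η] = [X, Y] + ℒ_X η - ℒ_Y ξ - (1/2) d(ι_X η - ι_Y ξ)`. -/
def courant (s t : M → GenVec E) (x : M) : GenVec E :=
  (lieBracketField (fun z => (s z).1) (fun z => (t z).1) x,
    lieDerivOneForm (fun z => (s z).1) (fun z => (t z).2) x -
      lieDerivOneForm (fun z => (t z).1) (fun z => (s z).2) x -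
      (1 / 2 : ℝ) • dFun (fun z => (t z).2 (s z).1 - (s z).2 (t z).1) x)

/-- The Nijenhuis tensor `-[Js, Jt] + J[Js, t] + J[s, Jt] + [s, t]` for the Courant bracket. -/
def nijenhuis (J : M → GenVec E →L[ℝ] GenVec E) (s t : M → GenVec E) (x : M) : GenVec E :=
  -courant (fun z => J z (s z)) (fun z => J z (t z)) x + J x (courant (fun z => J z (s z)) t x) +
    J x (courant s (fun z => J z (t z)) x) + courant s t x

/-! ### Generalized-complex structures and their B-transforms -/

variable (E M) in
/-- A generalized-almost-complex structure: a smooth orthogonal endomorphism of `TM ⊕ T^*M` of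
square `-1`. -/
structure GenAlmostComplex where
  /-- the endomorphism -/
  toFun : M → GenVec E →L[ℝ] GenVec E
  smooth : SmoothEndo toFun
  orthogonal : ∀ (x : M) (a b : GenVec E), pairing (toFun x a) (toFun x b) = pairing a b
  sq : ∀ (x : M) (a : GenVec E), toFun x (toFun x a) = -a

/-- A generalized-almost-complex structure is generalized-complex if its Nijenhuis tensor
vanishes. -/
def GenAlmostComplex.IsGenComplex (J : GenAlmostComplex E M) : Prop :=
  ∀ s t : M → GenVec E, SmoothSection s → SmoothSection t → ∀ x : M, nijenhuis J.toFun s t x = 0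

variable (E M) in
/-- A real `d`-closed (smooth) `2`-form. -/
structure ClosedTwoForm where
  /-- the form -/
  toFun : M → E [⋀^Fin 2]→L[ℝ] ℝ
  smooth : SmoothForm toFun
  closed : ∀ x : M, extD toFun x = 0

theorem smoothForm_neg {k : ℕ} {θ : M → E [⋀^Fin k]→L[ℝ] F} (h : SmoothForm θ) :
    SmoothForm (fun x => -θ x) := fun x₀ => (h x₀).neg

section Charts

variable [IsManifold 𝓘(ℝ, E) ∞ M]

theorem dChartSymm_dChart (x₀ : M) {y : E} (hy : y ∈ (chartAt E x₀).target) (v : E) :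
    dChartSymm M x₀ y (dChart E x₀ ((chartAt E x₀).symm y) v) = v := by
  have h := (mdifferentiable_chart (I := 𝓘(ℝ, E)) x₀).symm_comp_deriv
    ((chartAt E x₀).map_target hy)
  rw [(chartAt E x₀).right_inv hy] at h
  exact DFunLike.congr_fun h v

theorem dChart_dChartSymm (x₀ : M) {y : E} (hy : y ∈ (chartAt E x₀).target) (v : E) :
    dChart E x₀ ((chartAt E x₀).symm y) (dChartSymm M x₀ y v) = v :=
  DFunLike.congr_fun ((mdifferentiable_chart (I := 𝓘(ℝ, E)) x₀).comp_symm_deriv hy) v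

theorem genOfChart_genToChart (x₀ : M) {y : E} (hy : y ∈ (chartAt E x₀).target) (a : GenVec E) :
    genOfChart x₀ y (genToChart x₀ y a) = a := by
  refine Prod.ext (dChartSymm_dChart x₀ hy a.1) ?_
  ext v
  exact congrArg a.2 (dChartSymm_dChart x₀ hy v)

theorem genToChart_genOfChart (x₀ : M) {y : E} (hy : y ∈ (chartAt E x₀).target) (a : GenVec E) :
    genToChart x₀ y (genOfChart x₀ y a) = a := by
  refine Prod.ext (dChart_dChartSymm x₀ hy a.1) ?_
  ext v
  exact congrArg a.2 (dChart_dChartSymm x₀ hy v)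

theorem endoInChart_expB (B : M → E [⋀^Fin 2]→L[ℝ] ℝ) (x₀ : M) {y : E}
    (hy : y ∈ (chartAt E x₀).target) :
    endoInChart (fun x => expB (B x)) x₀ y = expB (formInChart B x₀ y) := by
  refine ContinuousLinearMap.ext fun a => ?_
  have h : endoInChart (fun x => expB (B x)) x₀ y a =
      genToChart x₀ y (genOfChart x₀ y a) + genToChart x₀ y
        (0, twoFormMap (B ((chartAt E x₀).symm y)) (dChartSymm M x₀ y a.1)) := by
    rw [← map_add]
    simp only [endoInChart, ContinuousLinearMap.comp_apply, expB_apply]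
    congr 1
    refine Prod.ext ?_ ?_
    · simp [genOfChart]
    · simp [genOfChart]
  rw [h, genToChart_genOfChart x₀ hy, expB_apply]
  refine Prod.ext ?_ ?_
  · simp [genToChart]
  · ext v
    simp only [genToChart, formInChart, Prod.snd_add, add_apply,
      twoFormMap_apply, ContinuousAlternatingMap.compContinuousLinearMap_apply]
    congr 1
    change twoFormMap _ _ _ = _
    rw [twoFormMap_apply]
    congr 1
    funext i
    fin_cases i <;> rfl

theorem contDiff_expB : ContDiff ℝ ∞ (expB : (E [⋀^Fin 2]→L[ℝ] ℝ) → _) := by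
  have h : ContDiff ℝ ∞ (fun B : E [⋀^Fin 2]→L[ℝ] ℝ => B.curryLeft) :=
    have hg : ContDiff ℝ ∞ (ContinuousAlternatingMap.curryLeftLI (𝕜 := ℝ) (E := E) (F := ℝ)
        (n := 1)).toContinuousLinearMap := by
      exact ContinuousLinearMap.contDiff _
    hg
  unfold expB twoFormMap
  exact contDiff_const.add (contDiff_const.clm_comp ((contDiff_const.clm_comp h).clm_comp
    contDiff_const))

theorem smoothEndo_expB {B : M → E [⋀^Fin 2]→L[ℝ] ℝ} (hB : SmoothForm B) :
    SmoothEndo (fun x => expB (B x)) := fun x₀ =>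
  (contDiff_expB.comp_contDiffOn (hB x₀)).congr fun _ hy => endoInChart_expB B x₀ hy

theorem smoothEndo_comp {J K : M → GenVec E →L[ℝ] GenVec E} (hJ : SmoothEndo J)
    (hK : SmoothEndo K) : SmoothEndo (fun x => J x ∘L K x) := fun x₀ =>
  ((hJ x₀).clm_comp (hK x₀)).congr fun y hy => by
    refine ContinuousLinearMap.ext fun a => ?_
    simp only [endoInChart, ContinuousLinearMap.comp_apply]
    rw [genOfChart_genToChart x₀ hy]

end Charts

theorem pairing_expB {V : Type*} [NormedAddCommGroup V] [NormedSpace ℝ V]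
    (B : V [⋀^Fin 2]→L[ℝ] ℝ) (a b : GenVec V) :
    pairing (expB B a) (expB B b) = pairing a b := by
  have h : B ![b.1, a.1] = -B ![a.1, b.1] := by
    refine Eq.trans ?_ (B.toAlternatingMap.map_swap ![a.1, b.1] (i := 0) (j := 1) (by decide))
    change B _ = B _
    congr 1
    funext i
    fin_cases i <;> rfl
  simp only [pairing, expB_apply, add_apply, twoFormMap_apply, h]
  ring

theorem expB_neg_expB {V : Type*} [NormedAddCommGroup V] [NormedSpace ℝ V]
    (B : V [⋀^Fin 2]→L[ℝ] ℝ) (a : GenVec V) : expB (-B) (expB B a) = a := by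
  refine Prod.ext ?_ ?_
  · simp [expB_apply]
  · ext v
    simp [expB_apply, twoFormMap_apply]

/-- The B-transform `𝒥_B = exp(-B) 𝒥 exp B`. -/
def GenAlmostComplex.bTransform [IsManifold 𝓘(ℝ, E) ∞ M] (J : GenAlmostComplex E M)
    (B : ClosedTwoForm E M) : GenAlmostComplex E M where
  toFun x := expB (-B.toFun x) ∘L J.toFun x ∘L expB (B.toFun x)
  smooth := smoothEndo_comp (smoothEndo_expB (smoothForm_neg B.smooth))
    (smoothEndo_comp J.smooth (smoothEndo_expB B.smooth))
  orthogonal x a b := by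
    simp only [ContinuousLinearMap.comp_apply, pairing_expB, J.orthogonal]
  sq x a := by
    have h := expB_neg_expB (-B.toFun x)
    rw [neg_neg] at h
    simp only [ContinuousLinearMap.comp_apply, h, J.sq, map_neg, expB_neg_expB]

/-! ### De Rham cohomology and `C^∞`-pure-and-fullness -/

/-- Smoothness of a complex multiform field on `M`, that is, of all its components. -/
def SmoothMultiform (α : M → Multiform E) : Prop :=
  ∀ k : ℕ, SmoothForm (fun x => α x k)

/-- The exterior derivative on complex multiform fields. -/
def extDTotal (α : M → Multiform E) (x : M) : Multiform E
  | 0 => 0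
  | k + 1 => extD (fun z => α z k) x

theorem formInChart_differentiableAt {k : ℕ} {θ : M → E [⋀^Fin k]→L[ℝ] F} (h : SmoothForm θ)
    (x : M) : DifferentiableAt ℝ (formInChart θ x) (chartAt E x x) :=
  ((h x).contDiffAt ((chartAt E x).open_target.mem_nhds (mem_chart_target E x))).differentiableAt
    (by simp)

theorem extDTotal_add {α β : M → Multiform E} (hα : SmoothMultiform α) (hβ : SmoothMultiform β) :
    extDTotal (α + β) = extDTotal α + extDTotal β := by
  funext x k
  cases k with
  | zero => exact (add_zero (0 : E [⋀^Fin 0]→L[ℝ] ℂ)).symm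
  | succ k =>
    have := extDeriv_add (formInChart_differentiableAt (hα k) x)
      (formInChart_differentiableAt (hβ k) x)
    change (extDeriv (formInChart (fun z => α z k) x + formInChart (fun z => β z k) x)
      _).compContinuousLinearMap _ = _
    rw [this]
    rfl

theorem extDTotal_smul (c : ℂ) {α : M → Multiform E} (hα : SmoothMultiform α) :
    extDTotal (c • α) = c • extDTotal α := by
  funext x
  refine Multiform.ext fun k v => ?_
  cases k with
  | zero => exact (mul_zero c).symm
  | succ k =>
    have h := formInChart_differentiableAt (hα k) x
    change ContinuousAlternatingMap.alternatizeUncurryFin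
      (fderiv ℝ (c • formInChart (fun z => α z k) x) (chartAt E x x)) _ =
      c * ContinuousAlternatingMap.alternatizeUncurryFin
      (fderiv ℝ (formInChart (fun z => α z k) x) (chartAt E x x)) _
    rw [fderiv_const_smul h, ContinuousAlternatingMap.alternatizeUncurryFin_smul]
    rfl

variable (E M) in
/-- The smooth complex differential forms on `M` (of mixed degree). -/
def smoothForms : Submodule ℂ (M → Multiform E) where
  carrier := {α | SmoothMultiform α}
  zero_mem' := fun _ _ => contDiffOn_const (c := 0)
  add_mem' := fun hα hβ k x₀ => (hα k x₀).add (hβ k x₀)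
  smul_mem' := fun c _ hα k x₀ => (hα k x₀).const_smul c

variable (E M) in
/-- `ker d`: the closed smooth complex forms. -/
def closedForms : Submodule ℂ (M → Multiform E) where
  carrier := {α | α ∈ smoothForms E M ∧ extDTotal α = 0}
  zero_mem' := ⟨zero_mem _, by
    simpa using extDTotal_smul 0 (zero_mem (smoothForms E M))⟩
  add_mem' := fun ⟨hα, hα'⟩ ⟨hβ, hβ'⟩ => ⟨add_mem hα hβ, by
    rw [extDTotal_add hα hβ, hα', hβ', add_zero]⟩
  smul_mem' := fun c _ ⟨hα, hα'⟩ => ⟨Submodule.smul_mem _ c hα, by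
    rw [extDTotal_smul c hα, hα', smul_zero]⟩

variable (E M) in
/-- `im d`: the exterior derivatives of the smooth complex forms. -/
def exactForms : Submodule ℂ (M → Multiform E) where
  carrier := {α | ∃ γ ∈ smoothForms E M, extDTotal γ = α}
  zero_mem' := ⟨0, zero_mem _, by
    simpa using extDTotal_smul 0 (zero_mem (smoothForms E M))⟩
  add_mem' := by
    rintro _ _ ⟨γ, hγ, rfl⟩ ⟨δ, hδ, rfl⟩
    exact ⟨γ + δ, add_mem hγ hδ, extDTotal_add hγ hδ⟩
  smul_mem' := by
    rintro c _ ⟨γ, hγ, rfl⟩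
    exact ⟨c • γ, Submodule.smul_mem _ c hγ, extDTotal_smul c hγ⟩

variable (E M) in
/-- The de Rham cohomology `GH_dR(M) = ker d / im d` of complex forms. -/
abbrev DeRham : Type _ := closedForms E M ⧸ (exactForms E M).submoduleOf (closedForms E M)

/-- The closed forms that are sections of `U^k`. -/
def closedFormsInU (n : ℕ) (J : GenAlmostComplex E M) (k : ℤ) :
    Submodule ℂ (closedForms E M) where
  carrier := {α | ∀ x : M, (α : M → Multiform E) x ∈ gradedU n (J.toFun x) k}
  zero_mem' := fun _ => zero_mem _
  add_mem' := fun hα hβ x => add_mem (hα x) (hβ x)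
  smul_mem' := fun c _ hα x => Submodule.smul_mem _ c (hα x)

/-- `GH_𝒥^{(k)}(M)`: the classes in `GH_dR(M)` represented by closed sections of `U^k`. -/
def GHk (n : ℕ) (J : GenAlmostComplex E M) (k : ℤ) : Submodule ℂ (DeRham E M) :=
  (closedFormsInU n J k).map ((exactForms E M).submoduleOf (closedForms E M)).mkQ

/-- `C^∞`-pure: the sum of the `GH_𝒥^{(k)}(M)` is direct. -/
def IsPure (n : ℕ) (J : GenAlmostComplex E M) : Prop :=
  iSupIndep (GHk n J)

/-- `C^∞`-full: the `GH_𝒥^{(k)}(M)` span the de Rham cohomology. -/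
def IsFull (n : ℕ) (J : GenAlmostComplex E M) : Prop :=
  ⨆ k : ℤ, GHk n J k = ⊤

/-- `C^∞`-pure-and-full, on a manifold of dimension `2n`. -/
def IsPureAndFull (n : ℕ) (J : GenAlmostComplex E M) : Prop :=
  IsPure n J ∧ IsFull n J

end Manifold

end GenCplx

end

/-! The exterior product with `e^B` carries the data of `J` to the data of its B-transform,
pointwise and on cohomology.

On one tangent space, `B ∧ ·` has commutator `ι_X B ∧ ·` with the Clifford action of `a = X + ξ`,
and this commutator again commutes with `B ∧ ·`. Exponentiating gives `a · (e^B ∧ φ) = e^B ∧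
(exp(B)a · φ)` (`clifford_expWedge`). The `i`-eigenspace of the transform is `exp(-B) L`, and the
same holds for the conjugates because `B` is real. Therefore `e^B ∧ ·` maps `U^k` of `J` onto `U^k`
of the transform (`gradedU_bTransform`).

On the manifold, `dB = 0` makes `e^B ∧ ·` commute with `d` (`extDTotal_expWedgeField`). With its
inverse `e^{-B} ∧ ·` it preserves closed and exact forms, so it induces an automorphism of de Rham
cohomology. This automorphism maps each `GH^(k)` of `J` onto that of the transform
(`GHk_bTransform`), and linear automorphisms preserve direct sum decompositions. -/

namespace GenCplx

/-! ### Exterior products with covectors and 2-forms on one vector space. -/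

section Wedge

open ContinuousAlternatingMap

variable {V : Type*} [NormedAddCommGroup V] [NormedSpace ℝ V] {k : ℕ}

theorem wedgeCovector_apply (ξ : V →L[ℝ] ℝ) (φ : V [⋀^Fin k]→L[ℝ] ℂ) (v : Fin (k + 1) → V) :
    wedgeCovector ξ φ v =
      ∑ i : Fin (k + 1), (-1 : ℂ) ^ (i : ℕ) * ((ξ (v i) : ℂ) * φ (i.removeNth v)) := by
  simp [wedgeCovector, alternatizeUncurryFin_apply]

variable (V k) in
/-- The exterior product with a covector, as a continuous bilinear map. -/
noncomputable def wedgeCovectorL :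
    (V →L[ℝ] ℝ) →L[ℝ] (V [⋀^Fin k]→L[ℝ] ℂ) →L[ℝ] (V [⋀^Fin (k + 1)]→L[ℝ] ℂ) :=
  ContinuousLinearMap.compL ℝ _ _ _ (alternatizeUncurryFinCLM ℝ V ℂ) ∘L
    ContinuousLinearMap.smulRightL ℝ V (V [⋀^Fin k]→L[ℝ] ℂ)

@[simp]
theorem wedgeCovectorL_apply (ξ : V →L[ℝ] ℝ) (φ : V [⋀^Fin k]→L[ℝ] ℂ) :
    wedgeCovectorL V k ξ φ = wedgeCovector ξ φ := rfl

/-- The double alternatization of a map symmetric in its first two arguments vanishes; here the map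
is `ξ ⊗ ξ ⊗ φ`. -/
theorem wedgeCovector_self (ξ : V →L[ℝ] ℝ) (φ : V [⋀^Fin k]→L[ℝ] ℂ) :
    wedgeCovector ξ (wedgeCovector ξ φ) = 0 := by
  have h := alternatizeUncurryFin_alternatizeUncurryFinCLM_comp_of_symmetric
    (f := ξ.smulRight (ξ.smulRight φ)) (fun x y => by simp [smul_smul, mul_comm])
  rw [← h]
  unfold wedgeCovector
  congr 1
  ext x : 1
  simp

theorem wedgeCovector_comm (ξ η : V →L[ℝ] ℝ) (φ : V [⋀^Fin k]→L[ℝ] ℂ) :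
    wedgeCovector ξ (wedgeCovector η φ) = -wedgeCovector η (wedgeCovector ξ φ) := by
  have h := wedgeCovector_self (ξ + η) φ
  simp only [← wedgeCovectorL_apply, _root_.map_add, _root_.add_apply] at h
  simp only [wedgeCovectorL_apply, wedgeCovector_self, zero_add, add_zero] at h
  exact eq_neg_of_add_eq_zero_right h

theorem wedgeCovector_compContinuousLinearMap {V' : Type*} [NormedAddCommGroup V']
    [NormedSpace ℝ V'] (A : V' →L[ℝ] V) (ξ : V →L[ℝ] ℝ) (φ : V [⋀^Fin k]→L[ℝ] ℂ) :
    (wedgeCovector ξ φ).compContinuousLinearMap A =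
      wedgeCovector (ξ ∘L A) (φ.compContinuousLinearMap A) := by
  ext v
  simp only [wedgeCovector_apply, compContinuousLinearMap_apply]
  rfl

/-- The interior product of a vector with the exterior product of a covector and a form of
positive degree. -/
theorem curryLeft_wedgeCovector (ξ : V →L[ℝ] ℝ) (φ : V [⋀^Fin (k + 1)]→L[ℝ] ℂ) (X : V) :
    (wedgeCovector ξ φ).curryLeft X + wedgeCovector ξ (φ.curryLeft X) = ξ X • φ := by
  ext v
  change wedgeCovector ξ φ (Matrix.vecCons X v) + wedgeCovector ξ (φ.curryLeft X) v = _
  -- The term in which `ξ` takes the slot of `X` is the right-hand side; the others cancel one by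
  -- one against `ξ ∧ ι_X φ`.
  rw [wedgeCovector_apply, wedgeCovector_apply, Fin.sum_univ_succ, add_assoc,
    ← Finset.sum_add_distrib, Finset.sum_eq_zero]
  · simp [Fin.removeNth_zero, Matrix.vecCons]
  · intro i _
    have : i.succ.removeNth (Matrix.vecCons X v) = Matrix.vecCons X (i.removeNth v) := by
      funext j
      cases j using Fin.cases <;> simp [Fin.removeNth]
    rw [this]
    simp [pow_succ]

theorem curryLeft_wedgeCovector_zero (ξ : V →L[ℝ] ℝ) (φ : V [⋀^Fin 0]→L[ℝ] ℂ) (X : V) :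
    (wedgeCovector ξ φ).curryLeft X = ξ X • φ := by
  ext v
  change wedgeCovector ξ φ (Matrix.vecCons X v) = _
  rw [wedgeCovector_apply]
  simp [Fin.removeNth_zero, Matrix.vecCons]

/-- `∑ i, e^i ∧ f(e_i)` is the alternatization of `f`. -/
theorem sum_wedgeCovector_coord {ι : Type*} [Fintype ι] (b : Module.Basis ι ℝ V)
    [FiniteDimensional ℝ V]
    (f : V →L[ℝ] V [⋀^Fin k]→L[ℝ] ℂ) :
    ∑ i, wedgeCovector (b.coord i).toContinuousLinearMap (f (b i)) =
      alternatizeUncurryFin f := by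
  have hf : f = ∑ i, (b.coord i).toContinuousLinearMap.smulRight (f (b i)) := by
    ext1 x
    conv_lhs => rw [← b.sum_repr x]
    simp [-Module.Basis.sum_repr, _root_.map_sum]
  conv_rhs => rw [hf, ← alternatizeUncurryFinCLM_apply, _root_.map_sum]
  rfl

variable (V) in
/-- `twoFormMap` as a continuous linear map. -/
noncomputable def twoFormMapL : (V [⋀^Fin 2]→L[ℝ] ℝ) →L[ℝ] V →L[ℝ] V →L[ℝ] ℝ :=
  ContinuousLinearMap.compL ℝ V _ _
    ((ofSubsingletonLIE (𝕜 := ℝ) (E := V) (F := ℝ) (0 : Fin 1)).symm.toContinuousLinearEquiv :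
      (V [⋀^Fin 1]→L[ℝ] ℝ) →L[ℝ] (V →L[ℝ] ℝ)) ∘L
    (curryLeftLI (𝕜 := ℝ) (E := V) (F := ℝ) (n := 1)).toContinuousLinearMap

theorem twoFormMap_swap (B : V [⋀^Fin 2]→L[ℝ] ℝ) (X Y : V) :
    twoFormMap B X Y = -twoFormMap B Y X := by
  rw [twoFormMap_apply, twoFormMap_apply]
  refine Eq.trans ?_ (B.toAlternatingMap.map_swap ![Y, X] (i := 0) (j := 1) (by decide))
  change B _ = B _
  congr 1
  funext i
  fin_cases i <;> rfl

theorem twoFormMap_compContinuousLinearMap {V' : Type*} [NormedAddCommGroup V']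
    [NormedSpace ℝ V'] (A : V' →L[ℝ] V) (B : V [⋀^Fin 2]→L[ℝ] ℝ) (X : V') :
    twoFormMap (B.compContinuousLinearMap A) X = twoFormMap B (A X) ∘L A := by
  ext Y
  simp only [twoFormMap_apply, compContinuousLinearMap_apply, ContinuousLinearMap.comp_apply]
  congr 1
  funext i
  fin_cases i <;> rfl

variable (V k) in
/-- The exterior product of a real `2`-form and a complex `k`-form, as a continuous bilinear map:
`B ∧ φ` is half of the alternatization of `X ↦ ι_X B ∧ φ`. -/
noncomputable def wedgeTwoL :
    (V [⋀^Fin 2]→L[ℝ] ℝ) →L[ℝ] (V [⋀^Fin k]→L[ℝ] ℂ) →L[ℝ] (V [⋀^Fin (k + 2)]→L[ℝ] ℂ) :=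
  (1 / 2 : ℝ) • ContinuousLinearMap.compL ℝ _ _ _ (alternatizeUncurryFinCLM ℝ V ℂ) ∘L
    ContinuousLinearMap.precompL V (wedgeCovectorL V k) ∘L twoFormMapL V

theorem wedgeTwoL_apply (B : V [⋀^Fin 2]→L[ℝ] ℝ) (φ : V [⋀^Fin k]→L[ℝ] ℂ) :
    wedgeTwoL V k B φ = (1 / 2 : ℝ) •
      alternatizeUncurryFin ((wedgeCovectorL V k).flip φ ∘L twoFormMap B) := rfl

/-- Naturality under any linear map, visible because `wedgeTwoL` is defined without a basis. It
identifies the chart expression of `B ∧ φ` with the product of the chart expressions. -/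
theorem wedgeTwoL_compContinuousLinearMap {V' : Type*} [NormedAddCommGroup V']
    [NormedSpace ℝ V'] (A : V' →L[ℝ] V) (B : V [⋀^Fin 2]→L[ℝ] ℝ) (φ : V [⋀^Fin k]→L[ℝ] ℂ) :
    (wedgeTwoL V k B φ).compContinuousLinearMap A =
      wedgeTwoL V' k (B.compContinuousLinearMap A) (φ.compContinuousLinearMap A) := by
  ext v
  simp only [wedgeTwoL_apply, compContinuousLinearMap_apply, ContinuousAlternatingMap.smul_apply,
    alternatizeUncurryFin_apply, ContinuousLinearMap.comp_apply, ContinuousLinearMap.flip_apply,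
    wedgeCovectorL_apply, twoFormMap_compContinuousLinearMap,
    ← wedgeCovector_compContinuousLinearMap]
  rfl

theorem alternatizeUncurryFin_vecCons (c : V →L[ℝ] V [⋀^Fin 2]→L[ℝ] ℝ) (X Y Z : V) :
    alternatizeUncurryFin c ![X, Y, Z] =
      twoFormMap (c X) Y Z + twoFormMap (c Y) Z X + twoFormMap (c Z) X Y := by
  rw [twoFormMap_swap (c Y), alternatizeUncurryFin_apply, Fin.sum_univ_three]
  simp only [twoFormMap_apply]
  have h₀ : (0 : Fin 3).removeNth ![X, Y, Z] = ![Y, Z] := by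
    funext i; fin_cases i <;> rfl
  have h₁ : (1 : Fin 3).removeNth ![X, Y, Z] = ![X, Z] := by
    funext i; fin_cases i <;> rfl
  have h₂ : (2 : Fin 3).removeNth ![X, Y, Z] = ![X, Y] := by
    funext i; fin_cases i <;> rfl
  rw [h₀, h₁, h₂]
  simp

/-- Rotating the indices leaves the sum unchanged, so three times the sum has the cyclic sums of `c`
as coefficients. -/
theorem sum_smul_eq_zero_of_cyclic {ι F : Type*} [Fintype ι] [AddCommGroup F] [Module ℝ F]
    {c : ι → ι → ι → ℝ} {T : ι → ι → ι → F}
    (hT : ∀ i j l, T i j l = T j l i) (hc : ∀ i j l, c i j l + c j l i + c l i j = 0) :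
    ∑ i, ∑ j, ∑ l, c i j l • T i j l = 0 := by
  have rotate : ∀ f : ι → ι → ι → F, ∑ i, ∑ j, ∑ l, f i j l = ∑ i, ∑ j, ∑ l, f j l i :=
    fun f => by
      refine (Finset.sum_congr rfl fun j _ => Finset.sum_comm).trans ?_
      rw [Finset.sum_comm]
  have h₁ : ∑ i, ∑ j, ∑ l, c i j l • T i j l = ∑ i, ∑ j, ∑ l, c j l i • T i j l := by
    rw [rotate]
    simp only [← hT]
  have h₂ : ∑ i, ∑ j, ∑ l, c j l i • T i j l = ∑ i, ∑ j, ∑ l, c l i j • T i j l := by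
    rw [rotate]
    simp only [← hT]
  have h₃ : (3 : ℝ) • ∑ i, ∑ j, ∑ l, c i j l • T i j l = 0 :=
    calc
      _ = ∑ i, ∑ j, ∑ l, c i j l • T i j l + ∑ i, ∑ j, ∑ l, c j l i • T i j l +
          ∑ i, ∑ j, ∑ l, c l i j • T i j l := by rw [← h₂, ← h₁]; module
      _ = 0 := by simp only [← Finset.sum_add_distrib, ← add_smul, hc, zero_smul,
        Finset.sum_const_zero]
  simpa using h₃

variable [FiniteDimensional ℝ V] {ι : Type*} [Fintype ι] (b : Module.Basis ι ℝ V)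

/-- Writes `B ∧ ·` through products of two covectors, so that its identities follow from
anticommutation. The factor 1/2 is there because `∑ e^i ∧ ι_{e_i} B = 2B`. -/
theorem wedgeTwoL_eq_sum (B : V [⋀^Fin 2]→L[ℝ] ℝ) (φ : V [⋀^Fin k]→L[ℝ] ℂ) :
    wedgeTwoL V k B φ = (1 / 2 : ℝ) • ∑ i, wedgeCovector (b.coord i).toContinuousLinearMap
      (wedgeCovector (twoFormMap B (b i)) φ) := by
  rw [wedgeTwoL_apply, ← sum_wedgeCovector_coord b]
  rfl

theorem wedgeTwoL_wedgeCovector (B : V [⋀^Fin 2]→L[ℝ] ℝ) (ξ : V →L[ℝ] ℝ)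
    (φ : V [⋀^Fin k]→L[ℝ] ℂ) :
    wedgeTwoL V (k + 1) B (wedgeCovector ξ φ) = wedgeCovector ξ (wedgeTwoL V k B φ) := by
  rw [wedgeTwoL_eq_sum (Module.finBasis ℝ V), wedgeTwoL_eq_sum (Module.finBasis ℝ V),
    ← wedgeCovectorL_apply ξ (_ • _), map_smul, _root_.map_sum]
  congr 1
  refine Finset.sum_congr rfl fun i _ => ?_
  rw [wedgeCovectorL_apply, wedgeCovector_comm ξ, wedgeCovector_comm ξ, ← wedgeCovectorL_apply,
    ← wedgeCovectorL_apply, ← wedgeCovectorL_apply, ← wedgeCovectorL_apply, map_neg, neg_neg]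

/-- Alternatization commutes with the exterior product with a fixed `2`-form. -/
theorem alternatizeUncurryFin_wedgeTwoL_comp (B : V [⋀^Fin 2]→L[ℝ] ℝ)
    (f : V →L[ℝ] V [⋀^Fin k]→L[ℝ] ℂ) :
    alternatizeUncurryFin (wedgeTwoL V k B ∘L f) =
      wedgeTwoL V (k + 1) B (alternatizeUncurryFin f) := by
  rw [← sum_wedgeCovector_coord (Module.finBasis ℝ V),
    ← sum_wedgeCovector_coord (Module.finBasis ℝ V), _root_.map_sum]
  exact Finset.sum_congr rfl fun i _ => (wedgeTwoL_wedgeCovector B _ _).symm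

/-- The exterior product with the alternatization of `c` vanishes if that alternatization does. -/
theorem alternatizeUncurryFin_flip_wedgeTwoL_comp {c : V →L[ℝ] V [⋀^Fin 2]→L[ℝ] ℝ}
    (hc : alternatizeUncurryFin c = 0) (φ : V [⋀^Fin k]→L[ℝ] ℂ) :
    alternatizeUncurryFin ((wedgeTwoL V k).flip φ ∘L c) = 0 := by
  set b := Module.finBasis ℝ V
  set e := fun i => (b.coord i).toContinuousLinearMap
  set T := fun i j l => wedgeCovector (e i) (wedgeCovector (e j) (wedgeCovector (e l) φ))
  -- A cyclic permutation of three covectors is even.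
  have hT : ∀ i j l, T i j l = T j l i := fun i j l => by
    change wedgeCovector _ (wedgeCovector _ _) = wedgeCovector _ (wedgeCovector _ _)
    rw [wedgeCovector_comm (e i), wedgeCovector_comm (e i) (e l), ← wedgeCovectorL_apply (e j),
      ← wedgeCovectorL_apply (e j), map_neg, neg_neg]
  have hβ : ∀ β : V →L[ℝ] ℝ, β = ∑ l, β (b l) • e l := fun β => by
    ext x
    conv_lhs => rw [← b.sum_repr x]
    simp [-Module.Basis.sum_repr, _root_.map_sum, e, mul_comm]
  have hS : alternatizeUncurryFin ((wedgeTwoL V k).flip φ ∘L c) =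
      (1 / 2 : ℝ) • ∑ i, ∑ j, ∑ l, twoFormMap (c (b i)) (b j) (b l) • T i j l := by
    rw [← sum_wedgeCovector_coord b, Finset.smul_sum]
    refine Finset.sum_congr rfl fun i _ => ?_
    change wedgeCovector (e i) (wedgeTwoL V k (c (b i)) φ) = _
    rw [wedgeTwoL_eq_sum b, ← wedgeCovectorL_apply (e i), map_smul, _root_.map_sum]
    congr 1
    refine Finset.sum_congr rfl fun j _ => ?_
    conv_lhs => rw [hβ (twoFormMap (c (b i)) (b j))]
    simp only [← wedgeCovectorL_apply, _root_.map_sum, map_smul, _root_.sum_apply,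
      _root_.smul_apply, T]
    rfl
  -- The cyclic sums of the coefficients are the values of the alternatization of `c` on basis
  -- vectors, which vanish by `hc`.
  rw [hS, sum_smul_eq_zero_of_cyclic hT, smul_zero]
  intro i j l
  rw [← alternatizeUncurryFin_vecCons, hc]
  rfl

end Wedge

end GenCplx

/-! ### Commutators with exponentials of nilpotents. -/

/-- If the commutator `c` of `d` with a nilpotent `w` commutes with `w`, then
`d * exp w = exp w * (d + c)`. -/
theorem IsNilpotent.mul_exp_of_commutator {A : Type*} [Ring A] [Algebra ℚ A] {d w c : A}
    (hw : IsNilpotent w) (hd : d * w = w * d + c) (hc : Commute c w) :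
    d * IsNilpotent.exp w = IsNilpotent.exp w * (d + c) := by
  obtain ⟨N, hN⟩ := hw
  have hpow : ∀ i : ℕ, d * w ^ (i + 1) = w ^ (i + 1) * d + ((i + 1 : ℕ) : ℚ) • (w ^ i * c) := by
    intro i
    induction i with
    | zero => simp [hd]
    | succ i ih =>
      rw [_root_.pow_succ w (i + 1), ← mul_assoc, ih, add_mul, mul_assoc, hd, smul_mul_assoc,
        mul_assoc (w ^ i), hc.eq, ← mul_assoc (w ^ i), ← _root_.pow_succ, mul_add, ← mul_assoc]
      push_cast
      module
  -- Truncating at `N + 1` in the terms with `d` and at `N` in the term with `c` makes the sums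
  -- match after the index shift in `hpow`.
  have hN' : w ^ (N + 1) = 0 := by rw [_root_.pow_succ, hN, zero_mul]
  rw [mul_add]
  conv_lhs => rw [IsNilpotent.exp_eq_sum hN', Finset.mul_sum, Finset.sum_range_succ']
  conv_rhs =>
    congr
    · rw [IsNilpotent.exp_eq_sum hN', Finset.sum_mul, Finset.sum_range_succ']
    · rw [IsNilpotent.exp_eq_sum hN, Finset.sum_mul]
  have hterm : ∀ i : ℕ, d * (((i + 1).factorial : ℚ)⁻¹ • w ^ (i + 1)) =
      ((i + 1).factorial : ℚ)⁻¹ • w ^ (i + 1) * d + (i.factorial : ℚ)⁻¹ • w ^ i * c := by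
    intro i
    rw [mul_smul_comm, hpow, smul_add, smul_smul, smul_mul_assoc, smul_mul_assoc]
    congr 2
    rw [Nat.factorial_succ]
    push_cast
    field_simp
  simp only [hterm, Finset.sum_add_distrib]
  simp only [Nat.factorial_zero, Nat.cast_one, inv_one, pow_zero, one_smul, mul_one, one_mul]
  abel

namespace GenCplx

/-! ### The Clifford relations and the operator `e^B ∧ ·`. -/

section Exp

variable {V : Type*} [NormedAddCommGroup V] [NormedSpace ℝ V]

/-- Rational scalars, acting through `ℂ`, are what `IsNilpotent.exp` needs. -/
noncomputable instance : Algebra ℚ (Module.End ℂ (Multiform V)) :=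
  Algebra.compHom _ (algebraMap ℚ ℂ)

theorem End.rat_smul_apply (q : ℚ) (f : Module.End ℂ (Multiform V)) (φ : Multiform V) :
    (q • f) φ = (q : ℂ) • f φ := rfl

theorem clifford_zero_apply (a : GenVec V) (φ : Multiform V) :
    clifford a φ 0 = (φ 1).curryLeft a.1 := rfl

theorem clifford_succ_apply (a : GenVec V) (φ : Multiform V) (k : ℕ) :
    clifford a φ (k + 1) = (φ (k + 2)).curryLeft a.1 + wedgeCovector a.2 (φ k) := rfl

theorem curryLeft_curryLeft_self {k : ℕ} (φ : V [⋀^Fin (k + 2)]→L[ℝ] ℂ) (X : V) :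
    (φ.curryLeft X).curryLeft X = 0 := by
  ext v
  exact φ.map_eq_zero_of_eq _ (i := 0) (j := 1) rfl (by simp)

/-- Both `ι_X` and `ξ ∧ ·` square to zero, and the mixed terms add up to `ξ(X)`. Degrees 0 and 1 are
separate because some of these terms are absent there. -/
theorem clifford_mul_self (a : GenVec V) :
    (clifford a * clifford a : Module.End ℂ (Multiform V)) = (a.2 a.1 : ℂ) • 1 := by
  ext φ
  refine funext fun k => ?_
  change clifford a (clifford a φ) k = (a.2 a.1 : ℂ) • φ k
  have hs : (a.2 a.1 : ℂ) • φ k = a.2 a.1 • φ k := by ext; simp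
  rw [hs]
  rcases k with _ | _ | k
  · rw [clifford_zero_apply, clifford_succ_apply, ContinuousAlternatingMap.curryLeft_add,
      add_apply, curryLeft_curryLeft_self, zero_add, curryLeft_wedgeCovector_zero]
  · rw [clifford_succ_apply, clifford_succ_apply, clifford_zero_apply,
      ContinuousAlternatingMap.curryLeft_add, add_apply, curryLeft_curryLeft_self]
    simpa only [zero_add] using curryLeft_wedgeCovector a.2 (φ 1) a.1
  · have h : clifford a (clifford a φ) (k + 2) =
        ((φ (k + 4)).curryLeft a.1 + wedgeCovector a.2 (φ (k + 2))).curryLeft a.1 +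
          wedgeCovectorL V (k + 1) a.2
            ((φ (k + 2)).curryLeft a.1 + wedgeCovector a.2 (φ k)) := rfl
    rw [h, ContinuousAlternatingMap.curryLeft_add, add_apply, curryLeft_curryLeft_self, map_add,
      wedgeCovectorL_apply, wedgeCovectorL_apply, wedgeCovector_self, add_zero]
    simpa only [zero_add] using curryLeft_wedgeCovector a.2 (φ (k + 2)) a.1

/-- The Clifford relation. -/
theorem clifford_mul_add_mul (a b : GenVec V) :
    (clifford a * clifford b + clifford b * clifford a : Module.End ℂ (Multiform V)) =
      ((a.2 b.1 + b.2 a.1 : ℝ) : ℂ) • 1 := by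
  have h := clifford_mul_self (a + b)
  rw [map_add, add_mul, mul_add, mul_add, clifford_mul_self, clifford_mul_self] at h
  simp only [Prod.fst_add, Prod.snd_add, add_apply, map_add, Complex.ofReal_add, add_smul] at h ⊢
  have h' := congrArg (· - ((a.2 a.1 : ℂ) • (1 : Module.End ℂ (Multiform V)) +
    (b.2 b.1 : ℂ) • (1 : Module.End ℂ (Multiform V)))) h
  refine Eq.trans ?_ (h'.trans ?_) <;> abel

theorem clifford_inr_zero (ξ : V →L[ℝ] ℝ) (φ : Multiform V) : clifford (0, ξ) φ 0 = 0 := by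
  rw [clifford_zero_apply, map_zero]

theorem clifford_inr_succ (ξ : V →L[ℝ] ℝ) (φ : Multiform V) (k : ℕ) :
    clifford (0, ξ) φ (k + 1) = wedgeCovector ξ (φ k) := by
  rw [clifford_succ_apply, map_zero, zero_add]

variable [FiniteDimensional ℝ V] (B : V [⋀^Fin 2]→L[ℝ] ℝ)

/-- The exterior product `φ ↦ B ∧ φ` with a real `2`-form on multiforms. -/
noncomputable def wedgeTwo : Module.End ℂ (Multiform V) :=
  (1 / 2 : ℂ) • ∑ i, clifford (0, ((Module.finBasis ℝ V).coord i).toContinuousLinearMap) *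
    clifford (0, twoFormMap B (Module.finBasis ℝ V i))

theorem wedgeTwo_apply (φ : Multiform V) (k : ℕ) : wedgeTwo B φ k =
    (1 / 2 : ℂ) • ∑ i, clifford (0, ((Module.finBasis ℝ V).coord i).toContinuousLinearMap)
      (clifford (0, twoFormMap B (Module.finBasis ℝ V i)) φ) k := by
  simp only [wedgeTwo, LinearMap.smul_apply, LinearMap.sum_apply, Module.End.mul_apply]
  exact congrArg ((1 / 2 : ℂ) • ·)
    (Finset.sum_apply (M := fun k => V [⋀^Fin k]→L[ℝ] ℂ) k Finset.univ _)

theorem wedgeTwo_apply_zero (φ : Multiform V) : wedgeTwo B φ 0 = 0 := by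
  simp [wedgeTwo_apply, clifford_inr_zero]

theorem wedgeTwo_apply_one (φ : Multiform V) : wedgeTwo B φ 1 = 0 := by
  rw [wedgeTwo_apply]
  simp only [clifford_inr_succ, clifford_inr_zero, ← wedgeCovectorL_apply, map_zero]
  simp

theorem wedgeTwo_apply_add_two (φ : Multiform V) (k : ℕ) :
    wedgeTwo B φ (k + 2) = wedgeTwoL V k B (φ k) := by
  rw [wedgeTwo_apply, wedgeTwoL_eq_sum (Module.finBasis ℝ V)]
  simp only [clifford_inr_succ]
  ext
  simp

theorem wedgeTwo_neg : wedgeTwo (-B) = -wedgeTwo B := by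
  ext φ
  refine funext fun k => ?_
  change _ = -wedgeTwo B φ k
  rcases k with _ | _ | k
  · simp [wedgeTwo_apply_zero]
  · simp [wedgeTwo_apply_one]
  · simp [wedgeTwo_apply_add_two]

theorem wedgeTwo_pow_apply_of_lt (m : ℕ) (φ : Multiform V) {k : ℕ} (hk : k < 2 * m) :
    (wedgeTwo B ^ m) φ k = 0 := by
  induction m generalizing k with
  | zero => omega
  | succ m ih =>
    rw [pow_succ', Module.End.mul_apply]
    rcases k with _ | _ | k
    · exact wedgeTwo_apply_zero ..
    · exact wedgeTwo_apply_one ..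
    · rw [wedgeTwo_apply_add_two, ih (by omega), map_zero]

theorem form_eq_zero_of_finrank_lt {k : ℕ} (hk : Module.finrank ℝ V < k)
    (φ : V [⋀^Fin k]→L[ℝ] ℂ) : φ = 0 := by
  ext v
  refine φ.toAlternatingMap.map_linearDependent v fun h => ?_
  have := h.fintype_card_le_finrank
  rw [Fintype.card_fin] at this
  omega

/-- Components of degree below `2N` vanish because each factor raises the degree by two, the others
because they exceed the dimension. -/
theorem wedgeTwo_pow_eq_zero {N : ℕ} (hN : Module.finrank ℝ V < 2 * N) : wedgeTwo B ^ N = 0 := by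
  ext φ
  refine funext fun k => ?_
  rcases lt_or_ge k (2 * N) with hk | hk
  · exact wedgeTwo_pow_apply_of_lt B N φ hk
  · exact form_eq_zero_of_finrank_lt (hN.trans_le hk) _

theorem isNilpotent_wedgeTwo : IsNilpotent (wedgeTwo B) :=
  ⟨Module.finrank ℝ V + 1, wedgeTwo_pow_eq_zero B (by omega)⟩

/-- Moving `a` past the two covectors of each summand by the Clifford relation leaves two correction
terms. By antisymmetry of `B`, each of the two families sums to `ι_X B`, which cancels the factor
1/2. -/
theorem clifford_mul_wedgeTwo (a : GenVec V) :
    clifford a * wedgeTwo B = wedgeTwo B * clifford a + clifford (0, twoFormMap B a.1) := by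
  set b := Module.finBasis ℝ V with hb
  set e := fun i => (b.coord i).toContinuousLinearMap with he
  have hterm : ∀ i, clifford a * (clifford (0, e i) * clifford (0, twoFormMap B (b i))) =
      clifford (0, e i) * clifford (0, twoFormMap B (b i)) * clifford a +
        (clifford (0, e i a.1 • twoFormMap B (b i)) +
        clifford (0, twoFormMap B a.1 (b i) • e i) : Module.End ℂ (Multiform V)) := fun i => by
    have h₁ := clifford_mul_add_mul a (0, e i)
    have h₂ := clifford_mul_add_mul a (0, twoFormMap B (b i))
    simp only [map_zero, zero_add] at h₁ h₂
    have h₃ : ∀ (c : ℝ) (ξ : V →L[ℝ] ℝ), (clifford (0, c • ξ) : Module.End ℂ (Multiform V)) =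
        (c : ℂ) • clifford (0, ξ) := fun c ξ => by
      have : ((0, c • ξ) : GenVec V) = c • (0, ξ) := by simp
      rw [this, map_smul]
      rfl
    rw [h₃, h₃, twoFormMap_swap B a.1, ← mul_assoc, eq_sub_of_add_eq h₁, sub_mul, mul_assoc,
      eq_sub_of_add_eq h₂]
    simp only [mul_sub, mul_smul_comm, smul_mul_assoc, mul_one, one_mul, Complex.ofReal_neg,
      neg_smul, mul_assoc]
    abel
  have hsum : ∀ f : Fin (Module.finrank ℝ V) → V →L[ℝ] ℝ,
      ∑ i, (clifford (0, f i) : Module.End ℂ (Multiform V)) = clifford (0, ∑ i, f i) := fun f => by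
    rw [← map_sum]
    congr 1
    simp [Prod.ext_iff, Prod.fst_sum, Prod.snd_sum]
  have h₁ : ∑ i, e i a.1 • twoFormMap B (b i) = twoFormMap B a.1 := by
    conv_rhs => rw [← b.sum_repr a.1]
    simp [-Module.Basis.sum_repr, e]
  have h₂ : ∑ i, twoFormMap B a.1 (b i) • e i = twoFormMap B a.1 := by
    ext x
    conv_rhs => rw [← b.sum_repr x]
    simp [-Module.Basis.sum_repr, e, mul_comm]
  simp only [wedgeTwo, ← hb, mul_smul_comm, smul_mul_assoc, Finset.mul_sum, Finset.sum_mul]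
  change (1 / 2 : ℂ) • ∑ i, clifford a * (clifford (0, e i) * clifford (0, twoFormMap B (b i))) = _
  simp only [hterm, Finset.sum_add_distrib, hsum, h₁, h₂]
  module

theorem commute_clifford_inr_wedgeTwo (ξ : V →L[ℝ] ℝ) :
    Commute (clifford (0, ξ)) (wedgeTwo B) := by
  have h := clifford_mul_wedgeTwo B (0, ξ)
  rw [map_zero] at h
  rw [Commute, SemiconjBy, h]
  have : ((0, 0) : GenVec V) = 0 := rfl
  rw [this, map_zero, add_zero]

/-- The exterior product `φ ↦ e^B ∧ φ` with the exponential of a real `2`-form. -/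
noncomputable def expWedge : Multiform V ≃ₗ[ℂ] Multiform V :=
  LinearEquiv.ofLinearMap (IsNilpotent.exp (wedgeTwo B)) (IsNilpotent.exp (wedgeTwo (-B)))
    (by rw [wedgeTwo_neg]; exact IsNilpotent.exp_mul_exp_neg_self (isNilpotent_wedgeTwo B))
    (by rw [wedgeTwo_neg]; exact IsNilpotent.exp_neg_mul_exp_self (isNilpotent_wedgeTwo B))

theorem expWedge_apply (φ : Multiform V) : expWedge B φ = IsNilpotent.exp (wedgeTwo B) φ := rfl

theorem expWedge_symm : (expWedge B).symm = expWedge (-B) := by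
  ext φ
  rfl

/-- The length of the sum depends only on the dimension, so one finite sum serves at all points of
the manifold. -/
theorem expWedge_apply_eq_sum {N : ℕ} (hN : Module.finrank ℝ V < 2 * N) (φ : Multiform V) :
    expWedge B φ = ∑ i ∈ Finset.range N, ((i.factorial : ℂ)⁻¹) • (wedgeTwo B ^ i) φ := by
  rw [expWedge_apply, IsNilpotent.exp_eq_sum (wedgeTwo_pow_eq_zero B hN), LinearMap.sum_apply]
  simp [End.rat_smul_apply]

theorem clifford_expWedge (a : GenVec V) (φ : Multiform V) :
    clifford a (expWedge B φ) = expWedge B (clifford (expB B a) φ) := by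
  have h := IsNilpotent.mul_exp_of_commutator (isNilpotent_wedgeTwo B) (clifford_mul_wedgeTwo B a)
    (commute_clifford_inr_wedgeTwo B _)
  have ha : expB B a = a + (0, twoFormMap B a.1) := by simp [expB_apply, Prod.ext_iff]
  rw [ha, map_add]
  exact DFunLike.congr_fun h φ

theorem cliffordC_expWedge (v : ℂ ⊗[ℝ] GenVec V) (φ : Multiform V) :
    cliffordC v (expWedge B φ) =
      expWedge B (cliffordC ((expB B : GenVec V →ₗ[ℝ] GenVec V).baseChange ℂ v) φ) := by
  induction v using TensorProduct.induction_on with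
  | zero => simp
  | tmul z a => simp [cliffordC, clifford_expWedge]
  | add v w hv hw => simp [hv, hw]

end Exp

/-! ### Transformation of `L`, its conjugate and the spaces `U^k`. -/

section Spinors

variable {V : Type*} [NormedAddCommGroup V] [NormedSpace ℝ V]

/-- The `ℂ`-linear extension of `exp B` to `(V ⊕ V*) ⊗ ℂ`. -/
noncomputable def expBC (B : V [⋀^Fin 2]→L[ℝ] ℝ) : ℂ ⊗[ℝ] GenVec V →ₗ[ℂ] ℂ ⊗[ℝ] GenVec V :=
  (expB B : GenVec V →ₗ[ℝ] GenVec V).baseChange ℂ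

theorem expBC_neg_expBC (B : V [⋀^Fin 2]→L[ℝ] ℝ) (v : ℂ ⊗[ℝ] GenVec V) :
    expBC (-B) (expBC B v) = v := by
  induction v using TensorProduct.induction_on with
  | zero => simp
  | tmul z a => simp [expBC, expB_neg_expB]
  | add v w hv hw => simp [hv, hw]

theorem expBC_expBC_neg (B : V [⋀^Fin 2]→L[ℝ] ℝ) (v : ℂ ⊗[ℝ] GenVec V) :
    expBC B (expBC (-B) v) = v := by
  simpa using expBC_neg_expBC (-B) v

theorem conjC_expBC (B : V [⋀^Fin 2]→L[ℝ] ℝ) (v : ℂ ⊗[ℝ] GenVec V) :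
    conjC (expBC B v) = expBC B (conjC v) := by
  induction v using TensorProduct.induction_on with
  | zero => simp
  | tmul z a => simp [expBC, conjC]
  | add v w hv hw => simp [hv, hw]

variable (B : V [⋀^Fin 2]→L[ℝ] ℝ) (J : GenVec V →L[ℝ] GenVec V)

theorem mem_eigenL_bTransform (v : ℂ ⊗[ℝ] GenVec V) :
    v ∈ eigenL (expB (-B) ∘L J ∘L expB B) ↔ expBC B v ∈ eigenL J := by
  have h : ((expB (-B) ∘L J ∘L expB B : GenVec V →L[ℝ] GenVec V) :
      GenVec V →ₗ[ℝ] GenVec V).baseChange ℂ v =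
      expBC (-B) ((J : GenVec V →ₗ[ℝ] GenVec V).baseChange ℂ (expBC B v)) := by
    induction v using TensorProduct.induction_on with
    | zero => simp
    | tmul z a => simp [expBC]
    | add v w hv hw => rw [map_add, hv, hw, map_add, map_add, map_add]
  rw [eigenL, eigenL, Module.End.mem_eigenspace_iff, Module.End.mem_eigenspace_iff, h]
  refine ⟨fun h => ?_, fun h => ?_⟩
  · rw [← map_smul, ← h, expBC_expBC_neg]
  · rw [h, map_smul, expBC_neg_expBC]

theorem mem_eigenLbar_bTransform (v : ℂ ⊗[ℝ] GenVec V) :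
    v ∈ eigenLbar (expB (-B) ∘L J ∘L expB B) ↔ expBC B v ∈ eigenLbar J := by
  change conjC v ∈ eigenL _ ↔ conjC (expBC B v) ∈ eigenL J
  rw [mem_eigenL_bTransform, conjC_expBC]

variable [FiniteDimensional ℝ V]

/-- By `cliffordC_expWedge` the annihilator of `e^B ∧ ρ` is the image under `exp(-B)` of that of
`ρ`, just as the eigenspace of the transform is `exp(-B) L`. -/
theorem spinorLine_bTransform :
    spinorLine (expB (-B) ∘L J ∘L expB B) = (spinorLine J).map (expWedge B).toLinearMap := by
  rw [spinorLine, spinorLine, Submodule.map_span]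
  congr 1
  ext ρ
  simp only [LinearEquiv.coe_coe, (expWedge B).image_eq_preimage_symm, Set.mem_preimage,
    Set.mem_ofPred_eq, mem_eigenL_bTransform]
  obtain ⟨ρ, rfl⟩ := (expWedge B).surjective ρ
  simp only [LinearEquiv.symm_apply_apply, cliffordC_expWedge, LinearEquiv.map_eq_zero_iff,
    ← expBC.eq_1]
  exact ⟨fun h v => by simpa only [expBC_expBC_neg] using h (expBC (-B) v),
    fun h v => h (expBC B v)⟩

theorem lbarPowU_bTransform (m : ℕ) :
    lbarPowU (expB (-B) ∘L J ∘L expB B) m = (lbarPowU J m).map (expWedge B).toLinearMap := by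
  induction m with
  | zero => exact spinorLine_bTransform B J
  | succ m ih =>
    rw [lbarPowU, lbarPowU, ih]
    apply le_antisymm
    · rw [Submodule.map₂_le]
      rintro v hv _ ⟨φ, hφ, rfl⟩
      exact ⟨_, Submodule.apply_mem_map₂ _ ((mem_eigenLbar_bTransform B J v).1 hv) hφ,
        (cliffordC_expWedge B v φ).symm⟩
    · rw [Submodule.map_le_iff_le_comap, Submodule.map₂_le]
      intro v hv φ hφ
      -- The product `e^B ∧ (v · φ)` equals `exp(-B)v · (e^B ∧ φ)`.
      have h := Submodule.apply_mem_map₂ cliffordC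
        ((mem_eigenLbar_bTransform B J (expBC (-B) v)).2 (by rwa [expBC_expBC_neg]))
        (Submodule.mem_map_of_mem (f := (expWedge B).toLinearMap) hφ)
      rw [LinearEquiv.coe_coe, cliffordC_expWedge, ← expBC, expBC_expBC_neg] at h
      exact h

theorem gradedU_bTransform (n : ℕ) (k : ℤ) :
    gradedU n (expB (-B) ∘L J ∘L expB B) k =
      (gradedU n J k).map (expWedge B).toLinearMap := by
  unfold gradedU
  split_ifs
  · exact lbarPowU_bTransform B J _
  · rw [Submodule.map_bot]

end Spinors

/-! ### Forms at the centre of a chart. -/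

section Charts

open ContinuousAlternatingMap

variable {E : Type*} [NormedAddCommGroup E] [NormedSpace ℝ E] {M : Type*} [TopologicalSpace M]
  [ChartedSpace E M] [IsManifold 𝓘(ℝ, E) ∞ M]

theorem dChartSymm_comp_dChart_self (x : M) :
    dChartSymm M x (chartAt E x x) ∘L dChart E x x = ContinuousLinearMap.id ℝ E := by
  ext1 v
  have h := dChartSymm_dChart x (mem_chart_target E x) v
  rwa [(chartAt E x).left_inv (mem_chart_source E x)] at h

theorem dChart_comp_dChartSymm_self (x : M) :
    dChart E x x ∘L dChartSymm M x (chartAt E x x) = ContinuousLinearMap.id ℝ E := by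
  ext1 v
  have h := dChart_dChartSymm x (mem_chart_target E x) v
  rwa [(chartAt E x).left_inv (mem_chart_source E x)] at h

theorem formInChart_self_comp_dChart {F : Type*} [NormedAddCommGroup F] [NormedSpace ℝ F] {k : ℕ}
    (θ : M → E [⋀^Fin k]→L[ℝ] F) (x : M) :
    (formInChart θ x (chartAt E x x)).compContinuousLinearMap (dChart E x x) = θ x := by
  ext v
  have h := fun u => DFunLike.congr_fun (dChartSymm_comp_dChart_self (E := E) x) u
  simp only [ContinuousLinearMap.comp_apply] at h
  rw [formInChart, (chartAt E x).left_inv (mem_chart_source E x)]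
  simp only [compContinuousLinearMap_apply, Function.comp_def, h]
  rfl

/-- The differential of the chart is invertible at its centre, so the pullback along it in `extD`
can be undone. -/
theorem extDeriv_formInChart_of_extD_eq_zero {F : Type*} [NormedAddCommGroup F] [NormedSpace ℝ F]
    {k : ℕ} {θ : M → E [⋀^Fin k]→L[ℝ] F} {x : M} (h : extD θ x = 0) :
    extDeriv (formInChart θ x) (chartAt E x x) = 0 := by
  ext v
  have h' := DFunLike.congr_fun h (dChartSymm M x (chartAt E x x) ∘ v)
  have hu := fun u => DFunLike.congr_fun (dChart_comp_dChartSymm_self (E := E) x) u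
  simp only [ContinuousLinearMap.comp_apply] at hu
  simp only [extD, compContinuousLinearMap_apply, Function.comp_def, hu] at h'
  exact h'

end Charts

/-! ### Multiform fields, the exterior derivative and cohomology. -/

section Fields

open ContinuousAlternatingMap

variable {E : Type*} [NormedAddCommGroup E] [NormedSpace ℝ E] [FiniteDimensional ℝ E]

/-- The exterior product with a `2`-form that is closed at a point commutes there with the exterior
derivative. -/
theorem extDeriv_wedgeTwoL {k : ℕ} {b : E → E [⋀^Fin 2]→L[ℝ] ℝ} {f : E → E [⋀^Fin k]→L[ℝ] ℂ}
    {y : E} (hb : DifferentiableAt ℝ b y) (hf : DifferentiableAt ℝ f y)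
    (hd : extDeriv b y = 0) :
    extDeriv (fun z => wedgeTwoL E k (b z) (f z)) y =
      wedgeTwoL E (k + 1) (b y) (extDeriv f y) := by
  have h := (wedgeTwoL E k).hasFDerivAt_of_bilinear hb.hasFDerivAt hf.hasFDerivAt
  rw [extDeriv, h.fderiv, alternatizeUncurryFin_add]
  have h₁ : (wedgeTwoL E k).precompR E (b y) (fderiv ℝ f y) =
    wedgeTwoL E k (b y) ∘L fderiv ℝ f y := rfl
  have h₂ : (wedgeTwoL E k).precompL E (fderiv ℝ b y) (f y) =
    (wedgeTwoL E k).flip (f y) ∘L fderiv ℝ b y := rfl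
  -- Of the two Leibniz terms, the one differentiating `f` is `B ∧ df`; the one differentiating `b`
  -- vanishes since `db = 0` at `y`.
  rw [h₁, h₂, alternatizeUncurryFin_wedgeTwoL_comp, alternatizeUncurryFin_flip_wedgeTwoL_comp hd,
    add_zero]
  rfl

variable {M : Type*} [TopologicalSpace M] [ChartedSpace E M]

theorem smoothMultiform_wedgeTwo {B : M → E [⋀^Fin 2]→L[ℝ] ℝ} (hB : SmoothForm B)
    {α : M → Multiform E} (hα : SmoothMultiform α) :
    SmoothMultiform (fun x => wedgeTwo (B x) (α x)) := by
  intro k x₀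
  rcases k with _ | _ | k
  · simp only [wedgeTwo_apply_zero]
    exact zero_mem (smoothForms E M) 0 x₀
  · have h : (fun x => wedgeTwo (B x) (α x) 1) = fun _ => 0 :=
      funext fun x => wedgeTwo_apply_one (B x) (α x)
    rw [zero_add, h]
    exact zero_mem (smoothForms E M) 1 x₀
  · refine ((wedgeTwoL E k).isBoundedBilinearMap.contDiff.comp_contDiffOn
      ((hB x₀).prodMk (hα k x₀))).congr fun y _ => ?_
    simp only [formInChart, wedgeTwo_apply_add_two]
    exact wedgeTwoL_compContinuousLinearMap ..

variable (B : ClosedTwoForm E M)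

theorem smoothMultiform_wedgeTwo_pow (i : ℕ) {α : M → Multiform E} (hα : SmoothMultiform α) :
    SmoothMultiform (fun x => (wedgeTwo (B.toFun x) ^ i) (α x)) := by
  induction i with
  | zero => exact hα
  | succ i ih =>
    simp only [pow_succ', Module.End.mul_apply]
    exact smoothMultiform_wedgeTwo B.smooth ih

variable (E M) in
/-- The exterior derivative as a linear map on smooth forms. -/
noncomputable def extDSmooth : smoothForms E M →ₗ[ℂ] M → Multiform E where
  toFun α := extDTotal α
  map_add' α β := extDTotal_add α.2 β.2
  map_smul' c α := extDTotal_smul c α.2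

/-- The exterior product with `e^B` on multiform fields. -/
noncomputable def expWedgeField : (M → Multiform E) ≃ₗ[ℂ] (M → Multiform E) :=
  LinearEquiv.piCongrRight fun x => expWedge (B.toFun x)

theorem expWedgeField_apply (α : M → Multiform E) (x : M) :
    expWedgeField B α x = expWedge (B.toFun x) (α x) := rfl

theorem expWedgeField_eq_sum (α : M → Multiform E) :
    expWedgeField B α = ∑ i ∈ Finset.range (Module.finrank ℝ E + 1),
      (i.factorial : ℂ)⁻¹ • fun x => (wedgeTwo (B.toFun x) ^ i) (α x) := by
  funext x
  rw [expWedgeField_apply, expWedge_apply_eq_sum (N := Module.finrank ℝ E + 1) _ (by omega),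
    Finset.sum_apply]
  rfl

theorem expWedgeField_mem_smoothForms {α : M → Multiform E} (hα : α ∈ smoothForms E M) :
    expWedgeField B α ∈ smoothForms E M := by
  rw [expWedgeField_eq_sum]
  exact sum_mem fun i _ => Submodule.smul_mem _ _ (smoothMultiform_wedgeTwo_pow B i hα)

variable [IsManifold 𝓘(ℝ, E) ∞ M]

theorem extDTotal_wedgeTwo {α : M → Multiform E} (hα : SmoothMultiform α) :
    extDTotal (fun x => wedgeTwo (B.toFun x) (α x)) =
      fun x => wedgeTwo (B.toFun x) (extDTotal α x) := by
  have hd : ∀ (k : ℕ) (x : M), extD (fun _ : M => (0 : E [⋀^Fin k]→L[ℝ] ℂ)) x = 0 := fun k x => by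
    have h := extDTotal_smul (M := M) 0 (zero_mem (smoothForms E M))
    rw [zero_smul, zero_smul] at h
    exact congrFun (congrFun h x) (k + 1)
  funext x k
  -- Only from degree 3 on can `d(B ∧ α)` be nonzero; below, both sides vanish for degree reasons.
  rcases k with _ | _ | _ | k
  · exact (wedgeTwo_apply_zero ..).symm
  · rw [wedgeTwo_apply_one]
    simp only [extDTotal, wedgeTwo_apply_zero, hd]
  · rw [wedgeTwo_apply_add_two]
    simp only [extDTotal, wedgeTwo_apply_one, hd, _root_.map_zero]
  · rw [wedgeTwo_apply_add_two]
    simp only [extDTotal, wedgeTwo_apply_add_two]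
    have hchart : formInChart (fun z => wedgeTwoL E k (B.toFun z) (α z k)) x =
        fun y => wedgeTwoL E k (formInChart B.toFun x y) (formInChart (fun z => α z k) x y) :=
      funext fun y => wedgeTwoL_compContinuousLinearMap ..
    rw [extD, hchart, extDeriv_wedgeTwoL (formInChart_differentiableAt B.smooth x)
      (formInChart_differentiableAt (hα k) x) (extDeriv_formInChart_of_extD_eq_zero (B.closed x)),
      wedgeTwoL_compContinuousLinearMap, formInChart_self_comp_dChart]
    rfl

theorem extDTotal_wedgeTwo_pow (i : ℕ) {α : M → Multiform E} (hα : SmoothMultiform α) :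
    extDTotal (fun x => (wedgeTwo (B.toFun x) ^ i) (α x)) =
      fun x => (wedgeTwo (B.toFun x) ^ i) (extDTotal α x) := by
  induction i with
  | zero => rfl
  | succ i ih =>
    simp only [pow_succ', Module.End.mul_apply]
    rw [extDTotal_wedgeTwo B (smoothMultiform_wedgeTwo_pow B i hα), ih]

theorem extDTotal_expWedgeField {α : M → Multiform E} (hα : α ∈ smoothForms E M) :
    extDTotal (expWedgeField B α) = expWedgeField B (extDTotal α) := by
  -- Since `extDTotal` is known to be additive only on smooth forms, the sum is formed in that
  -- submodule, where `extDSmooth` is linear.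
  let w : ℕ → smoothForms E M := fun i => ⟨_, smoothMultiform_wedgeTwo_pow B i hα⟩
  have h : expWedgeField B α = (∑ i ∈ Finset.range (Module.finrank ℝ E + 1),
      (i.factorial : ℂ)⁻¹ • w i : smoothForms E M) := by
    rw [expWedgeField_eq_sum, Submodule.coe_sum]
    rfl
  rw [h]
  change extDSmooth E M _ = _
  rw [_root_.map_sum, expWedgeField_eq_sum]
  refine Finset.sum_congr rfl fun i _ => ?_
  rw [map_smul]
  exact congrArg _ (extDTotal_wedgeTwo_pow B i hα)

theorem expWedgeField_mem_closedForms {α : M → Multiform E} (hα : α ∈ closedForms E M) :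
    expWedgeField B α ∈ closedForms E M :=
  ⟨expWedgeField_mem_smoothForms B hα.1, by
    rw [extDTotal_expWedgeField B hα.1, hα.2, _root_.map_zero]⟩

theorem expWedgeField_mem_exactForms {α : M → Multiform E} (hα : α ∈ exactForms E M) :
    expWedgeField B α ∈ exactForms E M := by
  obtain ⟨γ, hγ, rfl⟩ := hα
  exact ⟨_, expWedgeField_mem_smoothForms B hγ, extDTotal_expWedgeField B hγ⟩

/-- The closed form `-B`. -/
noncomputable def ClosedTwoForm.neg : ClosedTwoForm E M where
  toFun x := -B.toFun x
  smooth := smoothForm_neg B.smooth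
  closed x := by
    have h : formInChart (fun z => -B.toFun z) x = (-1 : ℝ) • formInChart B.toFun x := by
      rw [neg_one_smul]
      rfl
    rw [extD, h, extDeriv_smul, extDeriv_formInChart_of_extD_eq_zero (B.closed x), smul_zero]
    rfl

/-- As the inverse is again of the form `e^B ∧ ·`, closed and exact forms are mapped onto
themselves, not merely into themselves. -/
theorem expWedgeField_symm : (expWedgeField B).symm = expWedgeField B.neg := by
  ext α x : 2
  exact DFunLike.congr_fun (expWedge_symm (B.toFun x)) (α x)

/-- The exterior product with `e^B` on closed forms. -/
noncomputable def expWedgeClosed : closedForms E M ≃ₗ[ℂ] closedForms E M :=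
  (expWedgeField B).ofSubmodules _ _ <| le_antisymm
    (Submodule.map_le_iff_le_comap.2 fun _ hα => expWedgeField_mem_closedForms B hα)
    fun α hα => ⟨(expWedgeField B).symm α, by
      rw [expWedgeField_symm]
      exact expWedgeField_mem_closedForms B.neg hα, (expWedgeField B).apply_symm_apply α⟩

/-- The automorphism of the de Rham cohomology given by the exterior product with `e^B`. -/
noncomputable def expWedgeDeRham : DeRham E M ≃ₗ[ℂ] DeRham E M :=
  Submodule.Quotient.equiv _ _ (expWedgeClosed B) <| le_antisymm
    (Submodule.map_le_iff_le_comap.2 fun _ hα => expWedgeField_mem_exactForms B hα)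
    fun α hα => ⟨(expWedgeClosed B).symm α, by
      change (expWedgeField B).symm α ∈ exactForms E M
      rw [expWedgeField_symm]
      exact expWedgeField_mem_exactForms B.neg hα, (expWedgeClosed B).apply_symm_apply α⟩

theorem closedFormsInU_bTransform (n : ℕ) (J : GenAlmostComplex E M) (k : ℤ) :
    closedFormsInU n (J.bTransform B) k =
      (closedFormsInU n J k).map (expWedgeClosed B).toLinearMap := by
  ext α
  obtain ⟨α, rfl⟩ := (expWedgeClosed B).surjective α
  rw [Submodule.mem_map_equiv, LinearEquiv.symm_apply_apply]
  refine forall_congr' fun x => ?_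
  change expWedge (B.toFun x) ((α : M → Multiform E) x) ∈
    gradedU n (expB (-B.toFun x) ∘L J.toFun x ∘L expB (B.toFun x)) k ↔ _
  rw [gradedU_bTransform, Submodule.mem_map_equiv, LinearEquiv.symm_apply_apply]

theorem GHk_bTransform (n : ℕ) (J : GenAlmostComplex E M) (k : ℤ) :
    GHk n (J.bTransform B) k = (GHk n J k).map (expWedgeDeRham B).toLinearMap := by
  rw [GHk, GHk, closedFormsInU_bTransform, ← Submodule.map_comp, ← Submodule.map_comp]
  rfl

/-- An automorphism of cohomology induces an order isomorphism of its lattice of subspaces, which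
preserves independence, suprema and the top element. -/
theorem isPureAndFull_bTransform (n : ℕ) (J : GenAlmostComplex E M) :
    IsPureAndFull n (J.bTransform B) ↔ IsPureAndFull n J := by
  have h : GHk n (J.bTransform B) = Submodule.orderIsoMapComap (expWedgeDeRham B) ∘ GHk n J :=
    funext fun k => GHk_bTransform B n J k
  refine and_congr ?_ ?_
  · rw [IsPure, IsPure, h, iSupIndep_map_orderIso_iff]
  · rw [IsFull, IsFull, h]
    simp only [Function.comp_apply, ← OrderIso.map_iSup, map_eq_top_iff]

end Fields

end GenCplx

theorem proposition2p5 {n : ℕ} {X : Type*} [TopologicalSpace X]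
    [ChartedSpace (EuclideanSpace ℝ (Fin (2 * n))) X]
    [IsManifold (𝓡 (2 * n)) ∞ X] [T2Space X] [CompactSpace X]
    (B : GenCplx.ClosedTwoForm (EuclideanSpace ℝ (Fin (2 * n))) X)
    (J : GenCplx.GenAlmostComplex (EuclideanSpace ℝ (Fin (2 * n))) X)
    (hJ : J.IsGenComplex) :
    GenCplx.IsPureAndFull n J ↔ GenCplx.IsPureAndFull n (J.bTransform B) := by
  exact (GenCplx.isPureAndFull_bTransform B n J).symm
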